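/- Let $K$ be an algebraically closed field of characteristic zero and let $n\ge d\ge 3$. Let $R_{d,n}=K[z_\alpha : \alpha\in\mathbf N^{n+1},\ |\alpha|=d]$ be the coordinate ring of the affine space $X_{d,n}$ of homogeneous polynomials $f=\sum_\alpha z_\alpha x^\alpha$ of degree $d$ in $x_0,\dots,x_n$. Consider the following ideals of $R_{d,n}$. (1) $J_{d,n}$ is the defining ideal of the variety $Y_{d,n}\subset X_{d,n}$ (the affine cone over the Chow variety) of all $f$ which are products of $d$ linear forms, i.e. the ideal of all elements of $R_{d,n}$ that vanish on $Y_{d,n}$. (2) $L_{d,n}$ is the ideal generated by Brill's equations, defined as follows. For homogeneous $g$ of degree $d$ let $g_{i,d-i}(x,y)$ be the part of $g(x+y)$ of bidegree $(i,d-i)$ in $(x,y)$, and for $g,h$ homogeneous of degree $d$ put $$(g\odot h)(x,y)=\sum_{k=0}^d(-1)^k\,k!\,(d-k)!\;g_{d-k,k}(x,y)\,h_{k,d-k}(x,y).$$ Let $f$ be the generic form, let $E_j(x,w)=f_{j,d-j}(x,w)f(w)^{j-1}$ for $1\le j\le d$, and let $Q(x,w)=P_d(E_1,\dots,E_d)$,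 where $P_d$ is the polynomial expressing the $d$-th power sum through the elementary symmetric functions. Brill's equations are the coefficients, with respect to the variables $x,y,w$, of $f\odot Q(\cdot,w)$ (with $\odot$ formed in the first set of variables); they are homogeneous of degree $d+1$ in the $z_\alpha$. (3) $I_{d,n,d+1}$ is the ideal generated by the $(d+1)\times(d+1)$ minors of the matrix over $R_{d,n}$ with columns indexed by $0\le i\le n$ and rows indexed by the monomials $x^\beta$ with $|\beta|=d-1$, whose entry is the coefficient of $x^\beta$ in $\partial f/\partial x_i$. Then $L_{d,n}\ne J_{d,n}$. More precisely, $I_{d,n,d+1}\subseteq J_{d,n}$ but $I_{d,n,d+1}\not\subseteq L_{d,n}$. -/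

import Mathlib

namespace Chow

open MvPolynomial

/-- The exponents `α = (α_0, …, α_n)` with `α_0 + ⋯ + α_n = d`, indexing the monomials of degree `d`
in `x_0, …, x_n`. -/
abbrev Exps (d n : ℕ) : Type :=
  ↥(Finset.finsuppAntidiag (Finset.univ : Finset (Fin (n + 1))) d)

/-- The polynomial `∑_α c_α x^α` of degree `d` in `x_0, …, x_n` with coefficients `c_α`. -/
noncomputable def formOf {S : Type*} [CommRing S] (d n : ℕ) (c : Exps d n → S) :
    MvPolynomial (Fin (n + 1)) S :=
  ∑ α : Exps d n, monomial α.1 (c α)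

/-- The coordinate ring `R = K[z_α]` of the affine space `X` of forms of degree `d` in `n + 1`
variables; `z_α` is the function "coefficient of `x^α`". -/
abbrev CoordRing (K : Type*) [Field K] (d n : ℕ) : Type _ :=
  MvPolynomial (Exps d n) K

/-- The generic form `∑_α z_α x^α`, with coefficients in the coordinate ring. -/
noncomputable def genericForm (K : Type*) [Field K] (d n : ℕ) :
    MvPolynomial (Fin (n + 1)) (CoordRing K d n) :=
  formOf d n (fun α => X α)

/-! ### The variety of products of linear forms -/

/-- The linear form `∑_j a_j x_j`. -/
noncomputable def linForm {S : Type*} [CommRing S] {n : ℕ} (a : Fin (n + 1) → S) :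
    MvPolynomial (Fin (n + 1)) S :=
  ∑ j, C (a j) * X j

/-- The variety `Y` of forms of degree `d` (given by their coefficients) that are products of `d`
linear forms. -/
def chowVariety (K : Type*) [Field K] (d n : ℕ) : Set (Exps d n → K) :=
  {c | ∃ l : Fin d → Fin (n + 1) → K, formOf d n c = ∏ i, linForm (l i)}

/-- The defining ideal `J` of `Y`: all polynomial functions on the space of forms that vanish
on `Y`. -/
noncomputable def chowIdeal (K : Type*) [Field K] (d n : ℕ) : Ideal (CoordRing K d n) :=
  vanishingIdeal K (chowVariety K d n)

/-! ### Brill's equations -/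

/-- `polar g i x y` is the coefficient of `T ^ i` in `g (T x + y)`; for `g` homogeneous of degree
`d` it is the part of `g (x + y)` of bidegree `(i, d - i)` in `(x, y)`. -/
noncomputable def polar {σ S B : Type*} [CommRing S] [CommRing B] [Algebra S B]
    (g : MvPolynomial σ S) (i : ℕ) (x y : σ → B) : B :=
  (aeval (fun j => Polynomial.X * Polynomial.C (x j) + Polynomial.C (y j)) g :
    Polynomial B).coeff i

/-- Newton's recursion
`p_k = e_1 p_{k-1} - e_2 p_{k-2} + ⋯ + (-1)^(k-2) e_{k-1} p_1 + (-1)^(k-1) k e_k`, which expresses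
the power sum `p_k` (`k ≥ 1`) as a polynomial in the elementary symmetric functions. -/
def powerSum {A : Type*} [CommRing A] (e : ℕ → A) : ℕ → A
  | 0 => 0
  | k + 1 => (-1) ^ k * ((k + 1 : ℕ) : A) * e (k + 1) +
      ∑ i : Fin k, (-1) ^ (i : ℕ) * e ((i : ℕ) + 1) * powerSum e (k - (i : ℕ))
termination_by k => k
decreasing_by omega

/-- For `j ≥ 1`, the polynomial `E_j (x, w) = f_{j, d-j} (x, w) * f (w) ^ (j - 1)`, where
`f_{j, d-j}` is the part of `f (x + w)` of degree `j` in `x`. It is a polynomial in `x` whose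
coefficients are polynomials in `w`. If `f = ℓ_1 ⋯ ℓ_d`, then `E_j (x, w) / f (w) ^ j` is the `j`-th
elementary symmetric function of the `ℓ_i (x) / ℓ_i (w)`. -/
noncomputable def brillE {σ S : Type*} [CommRing S] (f : MvPolynomial σ S) (j : ℕ) :
    MvPolynomial σ (MvPolynomial σ S) :=
  polar (B := MvPolynomial σ (MvPolynomial σ S)) f j X (fun s => C (X s)) * C f ^ (j - 1)

/-- `Q (x, w)`: the expression of the `d`-th power sum through the elementary symmetric functions,
evaluated at the `E_j`. It has degree `d` in `x` and `d (d - 1)` in `w`, and if `f = ℓ_1 ⋯ ℓ_d`, it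
is `∑_i ℓ_i (x) ^ d * ∏_{j ≠ i} ℓ_j (w) ^ d`. -/
noncomputable def brillQ {σ S : Type*} [CommRing S] (d : ℕ) (f : MvPolynomial σ S) :
    MvPolynomial σ (MvPolynomial σ S) :=
  powerSum (brillE f) d

/-- The vertical product `g ⊙ h` of two forms of degree `d`, a polynomial in two sets of variables
`x`, `y`. It is the bilinear operation with
`(ℓ_1 ⋯ ℓ_d) ⊙ (m_1 ⋯ m_d) = ∑_π ∏_i (ℓ_i (x) m_{π i} (y) - ℓ_i (y) m_{π i} (x))`, the sum being over
the permutations `π`; up to a scalar it is the projection of `Sym^d ⊗ Sym^d` onto the Schur functor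
of `(d, d)`, realized in `Sym^d (⋀^2)`. -/
noncomputable def verticalProduct {σ S : Type*} [CommRing S] (d : ℕ) (g h : MvPolynomial σ S) :
    MvPolynomial (σ ⊕ σ) S :=
  ∑ k ∈ Finset.range (d + 1),
    (-1) ^ k * ((k.factorial * (d - k).factorial : ℕ) : MvPolynomial (σ ⊕ σ) S) *
      polar g (d - k) (fun s => X (Sum.inl s)) (fun s => X (Sum.inr s)) *
      polar h k (fun s => X (Sum.inl s)) (fun s => X (Sum.inr s))

/-- Brill's covariant `f ⊙ Q (·, w)` of a form `f` of degree `d`; a polynomial in `x`, `y` whose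
coefficients are polynomials in `w`. -/
noncomputable def brillForm {σ S : Type*} [CommRing S] (d : ℕ) (f : MvPolynomial σ S) :
    MvPolynomial (σ ⊕ σ) (MvPolynomial σ S) :=
  verticalProduct d (map C f) (brillQ d f)

/-- The ideal `L` generated by Brill's equations, which are the coefficients of Brill's covariant of
the generic form. -/
noncomputable def brillIdeal (K : Type*) [Field K] (d n : ℕ) : Ideal (CoordRing K d n) :=
  Ideal.span {q | ∃ (a : Fin (n + 1) ⊕ Fin (n + 1) →₀ ℕ) (b : Fin (n + 1) →₀ ℕ),
    q = ((brillForm d (genericForm K d n)).coeff a).coeff b}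

/-! ### Rank equations -/

/-- The matrix of `ψ`, which sends the `i`-th basis vector to the partial derivative `∂ F / ∂ x_i`
of the generic form `F`: its entry at `(β, i)` is the coefficient of `x^β`, `|β| = d - 1`. -/
noncomputable def rankMatrix (K : Type*) [Field K] (d n : ℕ) :
    Matrix (Exps (d - 1) n) (Fin (n + 1)) (CoordRing K d n) :=
  Matrix.of fun β i => (pderiv i (genericForm K d n)).coeff β.1

/-- The ideal generated by the `r × r` minors of the matrix of `ψ`. -/
noncomputable def rankIdeal (K : Type*) [Field K] (d n r : ℕ) : Ideal (CoordRing K d n) :=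
  Ideal.span {q | ∃ (s : Fin r → Exps (d - 1) n) (t : Fin r → Fin (n + 1)),
    q = ((rankMatrix K d n).submatrix s t).det}

end Chow

/-! Brill's equations vanish at too many non-reduced points. Over a ring `A` in which `2` is
invertible, let `Z` be a matrix all of whose `2 × 2` permanents are zero and let `ℓ_j` be the linear
form with coefficients in its `j`-th row. Then `ℓ_j ℓ_k = 0` for all `j`, `k`, so the values of the
`ℓ_j` at any point generate an ideal of square zero. If `f` lies in the ideal generated by the
`ℓ_j`, then Brill's covariant of `f`, which has degree `d + 1` in `f`, lies in the `(d + 1)`-st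
power of the sum of three such ideals, belonging to the points `x`, `y` and `w`. This power is zero
for `d ≥ 3`.

Apply this to `f = ∑ j, x_j ^ (d - 1) ℓ_j`, where `A` is the ring of the universal such `Z`. The
rows `x_j ^ (d - 1)` of the matrix of partial derivatives give the entrywise product of `Z` with a
matrix of positive integers. Pairing its determinant with the generic determinant gives the
permanent of the matrix of integers, which is positive, while the ideal of `2 × 2` permanents pairs
to zero with the generic determinant. So the maximal minor does not lie in Brill's ideal, and by
Laplace expansion neither do all the smaller minors.

The minors of size greater than `d` vanish on products of `d` linear forms because there the Leibniz
rule factors the matrix of partial derivatives through a space of dimension `d`.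
-/

namespace Chow

open MvPolynomial
open scoped Matrix

section BaseChange

theorem map_formOf {S T : Type*} [CommRing S] [CommRing T] {d n : ℕ} (φ : S →+* T)
    (c : Exps d n → S) : map φ (formOf d n c) = formOf d n fun α => φ (c α) := by
  simp only [formOf, map_sum, map_monomial]

theorem map_aeval_genericForm {K A : Type*} [Field K] [CommRing A] [Algebra K A] {d n : ℕ}
    (z : Exps d n → A) :
    map (aeval z : CoordRing K d n →ₐ[K] A).toRingHom (genericForm K d n) = formOf d n z := by
  rw [genericForm, map_formOf]
  simp

theorem formOf_coeff {S : Type*} [CommRing S] {d n : ℕ} {f : MvPolynomial (Fin (n + 1)) S}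
    (hf : f.IsHomogeneous d) : formOf d n (fun α => f.coeff α.1) = f := by
  have hsupport : f.support ⊆ Finset.finsuppAntidiag Finset.univ d := fun α hα => by
    rw [Finset.mem_finsuppAntidiag, ← Finsupp.degree_eq_sum]
    exact ⟨by_contra fun h => mem_support_iff.1 hα (hf.coeff_eq_zero h), Finset.subset_univ _⟩
  rw [formOf, Finset.sum_coe_sort _ fun α => monomial α (f.coeff α),
    ← Finset.sum_subset hsupport, ← f.as_sum]
  intro α _ hα
  rw [notMem_support_iff.1 hα, map_zero]

theorem aeval_rankMatrix {K A : Type*} [Field K] [CommRing A] [Algebra K A] {d n : ℕ}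
    (z : Exps d n → A) (β : Exps (d - 1) n) (i : Fin (n + 1)) :
    aeval z (rankMatrix K d n β i) = (pderiv i (formOf d n z)).coeff β.1 := by
  rw [← map_aeval_genericForm (K := K), pderiv_map, coeff_map]
  rfl

variable {σ S T : Type*} [CommRing S] [CommRing T]

theorem polar_map {B B' : Type*} [CommRing B] [Algebra S B] [CommRing B'] [Algebra T B']
    {φ : S →+* T} {ψ : B →+* B'} (h : ψ.comp (algebraMap S B) = (algebraMap T B').comp φ)
    (g : MvPolynomial σ S) (i : ℕ) (x y : σ → B) :
    polar (map φ g) i (fun s => ψ (x s)) (fun s => ψ (y s)) = ψ (polar g i x y) := by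
  have hcomp : ((aeval fun s => Polynomial.X * Polynomial.C (ψ (x s)) + Polynomial.C (ψ (y s)) :
        MvPolynomial σ T →ₐ[T] Polynomial B').toRingHom.comp (map φ)) =
      (Polynomial.mapRingHom ψ).comp
        (aeval fun s => Polynomial.X * Polynomial.C (x s) + Polynomial.C (y s) :
          MvPolynomial σ S →ₐ[S] Polynomial B).toRingHom := by
    ext a : 2
    · simpa [Polynomial.algebraMap_apply] using (RingHom.congr_fun h a).symm
    · simp
  rw [polar, polar, ← Polynomial.coeff_map]
  exact congrArg (fun p => Polynomial.coeff p i) (RingHom.congr_fun hcomp g)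

theorem polar_map_algebraMap {B : Type*} [CommRing B] [Algebra S T] [Algebra S B] [Algebra T B]
    [IsScalarTower S T B] (g : MvPolynomial σ S) (i : ℕ) (x y : σ → B) :
    polar (map (algebraMap S T) g) i x y = polar g i x y :=
  congrArg (fun p => Polynomial.coeff p i) (aeval_map_algebraMap T _ g)

theorem map_powerSum (φ : S →+* T) (e : ℕ → S) (k : ℕ) :
    φ (powerSum e k) = powerSum (fun j => φ (e j)) k := by
  induction k using Nat.strong_induction_on with
  | _ k ih =>
    cases k with
    | zero => simp [powerSum]
    | succ k =>
      simp only [powerSum, map_add, map_sum, map_mul, map_pow, map_neg, map_one, map_natCast]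
      congr 1
      exact Finset.sum_congr rfl fun i _ => by rw [ih _ (by omega)]

variable (φ : S →+* T)

theorem brillE_map (f : MvPolynomial σ S) (j : ℕ) :
    brillE (map φ f) j = map (map φ) (brillE f j) := by
  have h : (map (map φ)).comp (algebraMap S (MvPolynomial σ (MvPolynomial σ S))) =
      (algebraMap T (MvPolynomial σ (MvPolynomial σ T))).comp φ := by
    refine RingHom.ext fun a => ?_
    simp only [RingHom.comp_apply, MvPolynomial.algebraMap_apply, algebraMap_eq, map_C]
  rw [brillE, brillE, map_mul, map_pow, map_C, ← polar_map h]
  simp only [map_X, map_C]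

theorem brillQ_map (d : ℕ) (f : MvPolynomial σ S) :
    brillQ d (map φ f) = map (map φ) (brillQ d f) := by
  rw [brillQ, brillQ, map_powerSum, funext (brillE_map φ f)]

theorem verticalProduct_map (d : ℕ) (g h : MvPolynomial σ S) :
    verticalProduct d (map φ g) (map φ h) = map φ (verticalProduct d g h) := by
  have hpolar (p : MvPolynomial σ S) (k : ℕ) :
      polar (map φ p) k (fun s => (X (Sum.inl s) : MvPolynomial (σ ⊕ σ) T))
          (fun s => X (Sum.inr s)) =
        map φ (polar p k (fun s => X (Sum.inl s)) (fun s => X (Sum.inr s))) := by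
    have hC : (map φ).comp (algebraMap S (MvPolynomial (σ ⊕ σ) S)) =
        (algebraMap T (MvPolynomial (σ ⊕ σ) T)).comp φ :=
      RingHom.ext fun a => map_C φ a
    rw [← polar_map hC]
    simp only [map_X]
  simp only [verticalProduct, map_sum, map_mul, map_pow, map_neg, map_one, map_natCast, hpolar]

theorem brillForm_map (d : ℕ) (f : MvPolynomial σ S) :
    brillForm d (map φ f) = map (map φ) (brillForm d f) := by
  have hC : map (C : T →+* MvPolynomial σ T) (map φ f) =
      map (map φ) (map (C : S →+* MvPolynomial σ S) f) := by
    rw [map_map, map_map]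
    exact congrArg (fun ψ => map ψ f) (RingHom.ext fun a => (map_C φ a).symm)
  rw [brillForm, brillForm, hC, brillQ_map, verticalProduct_map]

theorem brillIdeal_le_ker_aeval {K A : Type*} [Field K] [CommRing A] [Algebra K A] {d n : ℕ}
    {z : Exps d n → A} (hz : brillForm d (formOf d n z) = 0) :
    brillIdeal K d n ≤ RingHom.ker (aeval z : CoordRing K d n →ₐ[K] A) := by
  rw [brillIdeal, Ideal.span_le]
  rintro _ ⟨a, b, rfl⟩
  rw [← map_aeval_genericForm (K := K), brillForm_map] at hz
  have hcoeff := congrArg (fun p => coeff b (coeff a p)) hz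
  simp only [coeff_map, coeff_zero] at hcoeff
  exact hcoeff

end BaseChange

section RankEquations

theorem pderiv_linForm {S : Type*} [CommRing S] {n : ℕ} (a : Fin (n + 1) → S) (i : Fin (n + 1)) :
    pderiv i (linForm a) = C (a i) := by
  classical
  simp [linForm, pderiv_X, Pi.single_apply]

theorem derivation_prod {R A ι : Type*} [CommRing R] [CommRing A] [Algebra R A] [DecidableEq ι]
    (D : Derivation R A A) (s : Finset ι) (f : ι → A) :
    D (∏ k ∈ s, f k) = ∑ k ∈ s, D (f k) * ∏ m ∈ s.erase k, f m := by
  induction s using Finset.induction_on with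
  | empty => simp
  | insert a s ha ih =>
    rw [Finset.prod_insert ha, D.leibniz, ih, Finset.sum_insert ha, Finset.erase_insert ha,
      smul_eq_mul, smul_eq_mul, Finset.mul_sum, add_comm, mul_comm]
    congr 1
    refine Finset.sum_congr rfl fun k hk => ?_
    have hak : a ≠ k := fun h => ha (h ▸ hk)
    rw [Finset.erase_insert_of_ne hak, Finset.prod_insert (Finset.notMem_mono
      (Finset.erase_subset k s) ha), mul_left_comm]

theorem coeff_pderiv_prod_linForm {S : Type*} [CommRing S] {d n : ℕ}
    (l : Fin d → Fin (n + 1) → S) (i : Fin (n + 1)) (β : Fin (n + 1) →₀ ℕ) :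
    (pderiv i (∏ k, linForm (l k))).coeff β =
      ∑ k, l k i * (∏ m ∈ Finset.univ.erase k, linForm (l m)).coeff β := by
  simp only [derivation_prod, pderiv_linForm, coeff_sum, coeff_C_mul]

theorem det_mul_eq_zero_of_card_lt {R m n : Type*} [CommRing R] [IsDomain R] [Fintype m]
    [DecidableEq m] [Fintype n] (h : Fintype.card n < Fintype.card m) (M : Matrix m n R)
    (N : Matrix n m R) : (M * N).det = 0 := by
  by_contra hdet
  have hrank := (Matrix.rank_mul_le_left M N).trans M.rank_le_card_width
  rw [Matrix.rank_of_det_ne_zero hdet] at hrank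
  omega

theorem rankIdeal_le_chowIdeal (K : Type*) [Field K] {d r : ℕ} (n : ℕ) (hr : d < r) :
    rankIdeal K d n r ≤ chowIdeal K d n := by
  rw [rankIdeal, Ideal.span_le]
  rintro _ ⟨s, t, rfl⟩ c ⟨l, hl⟩
  have hfactor : (aeval c).mapMatrix ((rankMatrix K d n).submatrix s t) =
      (Matrix.of fun a k => (∏ m ∈ Finset.univ.erase k, linForm (l m)).coeff (s a).1) *
        (Matrix.of fun k b => l k (t b)) := by
    ext a b
    simp only [AlgHom.mapMatrix_apply, Matrix.map_apply, Matrix.submatrix_apply, aeval_rankMatrix,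
      hl, coeff_pderiv_prod_linForm, Matrix.mul_apply, Matrix.of_apply, mul_comm]
  rw [AlgHom.map_det, hfactor]
  exact det_mul_eq_zero_of_card_lt (by simpa using hr) _ _

theorem rankIdeal_antitone (K : Type*) [Field K] (d n : ℕ) : Antitone (rankIdeal K d n) := by
  refine antitone_nat_of_succ_le fun r => ?_
  rw [rankIdeal, Ideal.span_le]
  rintro _ ⟨s, t, rfl⟩
  rw [Matrix.det_succ_row_zero]
  refine Ideal.sum_mem _ fun j _ => Ideal.mul_mem_left _ _ (Ideal.subset_span ?_)
  exact ⟨s ∘ Fin.succ, t ∘ j.succAbove, by rw [Matrix.submatrix_submatrix]⟩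

end RankEquations

section SquareZero

variable {A σ : Type*} [CommRing A]

/-- The ideal generated by the values at the point `v` of the polynomials in `I`. The vanishing of
Brill's covariant is read off from the ideals of values at the points `x`, `y` and `w`. -/
noncomputable def idealAt (I : Ideal (MvPolynomial σ A)) {B : Type*} [CommRing B] [Algebra A B]
    (v : σ → B) : Ideal B :=
  I.map (aeval v : MvPolynomial σ A →ₐ[A] B)

theorem map_idealAt (I : Ideal (MvPolynomial σ A)) {B B' : Type*} [CommRing B] [Algebra A B]
    [CommRing B'] [Algebra A B'] (φ : B →ₐ[A] B') (v : σ → B) :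
    (idealAt I v).map φ = idealAt I fun s => φ (v s) := by
  rw [idealAt, idealAt, Ideal.map_mapₐ, comp_aeval]

theorem aeval_mem_idealAt {I : Ideal (MvPolynomial σ A)} {f : MvPolynomial σ A} (hf : f ∈ I)
    {B : Type*} [CommRing B] [Algebra A B] (v : σ → B) : aeval v f ∈ idealAt I v :=
  Ideal.mem_map_of_mem _ hf

theorem idealAt_sq_eq_zero {I : Ideal (MvPolynomial σ A)} (hI : I ^ 2 = ⊥)
    {B : Type*} [CommRing B] [Algebra A B] (v : σ → B) : idealAt I v ^ 2 = 0 := by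
  rw [idealAt, ← Ideal.map_pow, hI, Ideal.map_bot, Ideal.zero_eq_bot]

theorem aeval_mul_add_of_isHomogeneous_one {ℓ : MvPolynomial σ A} (hℓ : ℓ.IsHomogeneous 1)
    {B : Type*} [CommRing B] [Algebra A B] (t : B) (x y : σ → B) :
    aeval (fun s => t * x s + y s) ℓ = t * aeval x ℓ + aeval y ℓ := by
  rw [← mem_homogeneousSubmodule, homogeneousSubmodule_one_eq_span_X] at hℓ
  induction hℓ using Submodule.span_induction with
  | mem _ h =>
    obtain ⟨s, rfl⟩ := h
    simp only [aeval_X]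
  | zero => simp
  | add p q _ _ hp hq =>
    simp only [map_add, hp, hq]
    ring
  | smul a p _ hp => simp only [map_smul, hp, smul_add, mul_smul_comm]

theorem aeval_C_comp {B : Type*} [CommRing B] [Algebra A B] (v : σ → B) (f : MvPolynomial σ A) :
    aeval (fun s => Polynomial.C (v s)) f = Polynomial.C (aeval v f) :=
  aeval_algebraMap_apply (Polynomial B) v f

theorem idealAt_C_comp (I : Ideal (MvPolynomial σ A)) {B : Type*} [CommRing B] [Algebra A B]
    (v : σ → B) : idealAt I (fun s => Polynomial.C (v s)) = (idealAt I v).map Polynomial.C :=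
  (map_idealAt I (IsScalarTower.toAlgHom A B (Polynomial B)) v).symm

theorem idealAt_X_mul_C_add_C_le {L : Set (MvPolynomial σ A)} (hL : ∀ ℓ ∈ L, ℓ.IsHomogeneous 1)
    {B : Type*} [CommRing B] [Algebra A B] (x y : σ → B) :
    idealAt (Ideal.span L) (fun s => Polynomial.X * Polynomial.C (x s) + Polynomial.C (y s)) ≤
      (idealAt (Ideal.span L) x ⊔ idealAt (Ideal.span L) y).map Polynomial.C := by
  rw [idealAt, Ideal.map_le_iff_le_comap, Ideal.span_le]
  intro ℓ hℓ
  rw [SetLike.mem_coe, Ideal.mem_comap, aeval_mul_add_of_isHomogeneous_one (hL ℓ hℓ),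
    aeval_C_comp, aeval_C_comp, Ideal.map_sup]
  have hmem (v : σ → B) : Polynomial.C (aeval v ℓ) ∈ (idealAt (Ideal.span L) v).map Polynomial.C :=
    Ideal.mem_map_of_mem _ (aeval_mem_idealAt (Ideal.subset_span hℓ) v)
  exact Ideal.add_mem _ (Ideal.mul_mem_left _ _ (Ideal.mem_sup_left (hmem x)))
    (Ideal.mem_sup_right (hmem y))

theorem polar_mem_pow {B : Type*} [CommRing B] [Algebra A B] {J : Ideal (MvPolynomial σ A)}
    {M : Ideal B} {x y : σ → B}
    (hJ : idealAt J (fun s => Polynomial.X * Polynomial.C (x s) + Polynomial.C (y s)) ≤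
      M.map Polynomial.C)
    {g : MvPolynomial σ A} {k : ℕ} (hg : g ∈ J ^ k) (i : ℕ) : polar g i x y ∈ M ^ k := by
  have hmem : aeval (fun s => Polynomial.X * Polynomial.C (x s) + Polynomial.C (y s)) g ∈
      (M ^ k).map Polynomial.C := by
    rw [Ideal.map_pow]
    refine Ideal.pow_right_mono hJ k ?_
    rw [idealAt, ← Ideal.map_pow]
    exact Ideal.mem_map_of_mem _ hg
  exact Ideal.mem_map_C_iff.1 hmem i

theorem powerSum_mem_pow {I : Ideal A} {e : ℕ → A} (he : ∀ j, e (j + 1) ∈ I ^ (j + 1)) (k : ℕ) :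
    powerSum e k ∈ I ^ k := by
  induction k using Nat.strong_induction_on with
  | _ k ih =>
    cases k with
    | zero => simp
    | succ k =>
      rw [powerSum]
      refine Ideal.add_mem _ (Ideal.mul_mem_left _ _ (he k)) (Ideal.sum_mem _ fun i _ => ?_)
      have hdegree : k + 1 = (i + 1) + (k - i) := by omega
      rw [hdegree, pow_add, mul_assoc]
      exact Ideal.mul_mem_left _ _ (Ideal.mul_mem_mul (he i) (ih _ (by omega)))

variable {L : Set (MvPolynomial σ A)} {f : MvPolynomial σ A}

theorem polar_mem_idealAt (hL : ∀ ℓ ∈ L, ℓ.IsHomogeneous 1) (hf : f ∈ Ideal.span L)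
    {B : Type*} [CommRing B] [Algebra A B] (i : ℕ) (x y : σ → B) :
    polar f i x y ∈ idealAt (Ideal.span L) x ⊔ idealAt (Ideal.span L) y := by
  have h := polar_mem_pow (k := 1) (idealAt_X_mul_C_add_C_le hL x y) (by rwa [pow_one]) i
  rwa [pow_one] at h

theorem brillE_mem_pow (hL : ∀ ℓ ∈ L, ℓ.IsHomogeneous 1) (hf : f ∈ Ideal.span L) (j : ℕ) :
    brillE f (j + 1) ∈
      (idealAt (Ideal.span L) (X : σ → MvPolynomial σ (MvPolynomial σ A)) ⊔
        idealAt (Ideal.span L) (fun s => C (X s))) ^ (j + 1) := by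
  have hC : (C f : MvPolynomial σ (MvPolynomial σ A)) = aeval (fun s => C (X s)) f := by
    conv_lhs => rw [← aeval_X_left_apply f]
    exact (aeval_algebraMap_apply (MvPolynomial σ (MvPolynomial σ A)) X f).symm
  rw [brillE, Nat.add_sub_cancel, pow_succ', hC]
  exact Ideal.mul_mem_mul (polar_mem_idealAt hL hf _ _ _)
    (Ideal.pow_mem_pow (Ideal.mem_sup_right (aeval_mem_idealAt hf _)) _)

theorem polar_brillQ_mem_pow (hL : ∀ ℓ ∈ L, ℓ.IsHomogeneous 1) (hf : f ∈ Ideal.span L)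
    {B : Type*} [CommRing B] [Algebra A B] [Algebra (MvPolynomial σ A) B]
    [IsScalarTower A (MvPolynomial σ A) B] (d k : ℕ) (x y : σ → B) :
    polar (brillQ d f) k x y ∈
      (idealAt (Ideal.span L) x ⊔ idealAt (Ideal.span L) y ⊔
        idealAt (Ideal.span L) (fun s => algebraMap (MvPolynomial σ A) B (X s))) ^ d := by
  refine polar_mem_pow ?_ (powerSum_mem_pow (brillE_mem_pow hL hf) d) k
  let φ : MvPolynomial σ (MvPolynomial σ A) →ₐ[MvPolynomial σ A] Polynomial B :=
    aeval fun s => Polynomial.X * Polynomial.C (x s) + Polynomial.C (y s)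
  change Ideal.map (φ.restrictScalars A) _ ≤ _
  have hx : (fun s => φ.restrictScalars A (X s)) =
      fun s => Polynomial.X * Polynomial.C (x s) + Polynomial.C (y s) :=
    funext fun s => aeval_X _ s
  have hw : (fun s => φ.restrictScalars A (C (X s))) =
      fun s => Polynomial.C (algebraMap (MvPolynomial σ A) B (X s)) :=
    funext fun s => by
      rw [AlgHom.restrictScalars_apply, ← algebraMap_eq, φ.commutes, Polynomial.algebraMap_apply]
  rw [Ideal.map_sup, map_idealAt, map_idealAt, hx, hw, idealAt_C_comp, Ideal.map_sup]
  exact sup_le_sup_right (idealAt_X_mul_C_add_C_le hL x y) _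

theorem brillForm_mem_pow (hL : ∀ ℓ ∈ L, ℓ.IsHomogeneous 1) (hf : f ∈ Ideal.span L) (d : ℕ) :
    brillForm d f ∈
      (idealAt (Ideal.span L) (fun s => (X (Sum.inl s) : MvPolynomial (σ ⊕ σ) (MvPolynomial σ A))) ⊔
        idealAt (Ideal.span L) (fun s => X (Sum.inr s)) ⊔
        idealAt (Ideal.span L) (fun s => C (X s))) ^ (d + 1) := by
  rw [brillForm, verticalProduct, ← algebraMap_eq (R := A)]
  refine Ideal.sum_mem _ fun k _ => ?_
  rw [polar_map_algebraMap, mul_assoc, pow_succ']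
  exact Ideal.mul_mem_left _ _ (Ideal.mul_mem_mul
    (Ideal.mem_sup_left (polar_mem_idealAt hL hf _ _ _)) (polar_brillQ_mem_pow hL hf d k _ _))

theorem brillForm_eq_zero (hL : ∀ ℓ ∈ L, ℓ.IsHomogeneous 1) (hL2 : Ideal.span L ^ 2 = ⊥)
    (hf : f ∈ Ideal.span L) {d : ℕ} (hd : 3 ≤ d) : brillForm d f = 0 := by
  have h := brillForm_mem_pow hL hf d
  rw [← Ideal.add_eq_sup, ← Ideal.add_eq_sup,
    (Commute.all _ _).add_pow_eq_zero_of_add_le_succ_of_pow_eq_zero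
      ((Commute.all _ _).add_pow_eq_zero_of_add_le_succ_of_pow_eq_zero (k := 3)
        (idealAt_sq_eq_zero hL2 _) (idealAt_sq_eq_zero hL2 _) le_rfl)
      (idealAt_sq_eq_zero hL2 _) (by omega)] at h
  exact h

end SquareZero

section Permanental

variable {ι R : Type*} [CommRing R]

/-- The ideal of `2 × 2` permanents of the generic square matrix `(X (j, i))` over `R`. The two
rows, or the two columns, of a permanent are allowed to coincide. Modulo this ideal, the linear
forms given by any two rows have product zero, as soon as `2` is invertible. -/
noncomputable def permanentalIdeal (ι R : Type*) [CommRing R] : Ideal (MvPolynomial (ι × ι) R) :=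
  Ideal.span {p | ∃ j k i l, p = X (j, i) * X (k, l) + X (j, l) * X (k, i)}

variable [Fintype ι]

/-- The exponent of the monomial `∏ i, X (s i, i)`, which occurs with the sign of `s` in the generic
determinant. -/
noncomputable def permExp (s : Equiv.Perm ι) : ι × ι →₀ ℕ :=
  ∑ i, Finsupp.single (s i, i) 1

theorem permExp_apply [DecidableEq ι] (s : Equiv.Perm ι) (j i : ι) :
    permExp s (j, i) = if s i = j then 1 else 0 := by
  simp [permExp, Finsupp.finsetSum_apply, Finsupp.single_apply, and_comm (a := s _ = j), ite_and]

theorem permExp_injective : Function.Injective (permExp : Equiv.Perm ι → ι × ι →₀ ℕ) := by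
  classical
  intro s t h
  ext i
  have hi := DFunLike.congr_fun h (s i, i)
  simp only [permExp_apply, if_true] at hi
  exact (of_not_not fun hne => by simp [hne] at hi : t i = s i).symm

theorem apply_eq_of_add_single_eq_permExp {s : Equiv.Perm ι} {j i : ι} {m : ι × ι →₀ ℕ}
    (h : m + Finsupp.single (j, i) 1 = permExp s) : s i = j := by
  classical
  by_contra hne
  have hji := DFunLike.congr_fun h (j, i)
  simp [permExp_apply, hne] at hji

theorem add_single_add_single_ne_permExp (s : Equiv.Perm ι) (j k i : ι) (m : ι × ι →₀ ℕ) :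
    m + Finsupp.single (j, i) 1 + Finsupp.single (k, i) 1 ≠ permExp s := by
  classical
  intro h
  have hk : s i = k := apply_eq_of_add_single_eq_permExp h
  have hj : s i = j := apply_eq_of_add_single_eq_permExp (by rwa [add_right_comm] at h)
  have hki := DFunLike.congr_fun h (s i, i)
  rw [← hj, ← hk] at hki
  simp [permExp_apply] at hki

variable [DecidableEq ι]

theorem permExp_mul_swap (s : Equiv.Perm ι) {i l : ι} (hil : i ≠ l) :
    permExp (s * Equiv.swap i l) + Finsupp.single (s i, i) 1 + Finsupp.single (s l, l) 1 =
      permExp s + Finsupp.single (s l, i) 1 + Finsupp.single (s i, l) 1 := by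
  have hsplit (t : Equiv.Perm ι) : permExp t = Finsupp.single (t i, i) 1 +
      (Finsupp.single (t l, l) 1 + ∑ m ∈ (Finset.univ.erase i).erase l,
        Finsupp.single (t m, m) 1) := by
    rw [Finset.add_sum_erase _ (fun m => Finsupp.single (t m, m) 1) (by simp [hil.symm]),
      Finset.add_sum_erase _ (fun m => Finsupp.single (t m, m) 1) (Finset.mem_univ i), permExp]
  have hrest : ∑ m ∈ (Finset.univ.erase i).erase l,
      Finsupp.single ((s * Equiv.swap i l) m, m) 1 =
        ∑ m ∈ (Finset.univ.erase i).erase l, Finsupp.single (s m, m) 1 :=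
    Finset.sum_congr rfl fun m hm => by
      simp only [Finset.mem_erase] at hm
      rw [Equiv.Perm.mul_apply, Equiv.swap_apply_of_ne_of_ne hm.2.1 hm.1]
  rw [hsplit, hsplit s, hrest, Equiv.Perm.mul_apply, Equiv.Perm.mul_apply, Equiv.swap_apply_left,
    Equiv.swap_apply_right]
  abel

theorem permExp_mul_swap_eq {s : Equiv.Perm ι} {j k i l : ι} {m : ι × ι →₀ ℕ} (hil : i ≠ l)
    (h : m + Finsupp.single (j, i) 1 + Finsupp.single (k, l) 1 = permExp s) :
    m + Finsupp.single (j, l) 1 + Finsupp.single (k, i) 1 = permExp (s * Equiv.swap i l) := by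
  have hk : s l = k := apply_eq_of_add_single_eq_permExp h
  have hj : s i = j := apply_eq_of_add_single_eq_permExp (by rwa [add_right_comm] at h)
  have hswap := permExp_mul_swap s hil
  rw [← h, hj, hk] at hswap
  have hcancel : permExp (s * Equiv.swap i l) +
      (Finsupp.single (j, i) 1 + Finsupp.single (k, l) 1) =
      m + Finsupp.single (j, l) 1 + Finsupp.single (k, i) 1 +
      (Finsupp.single (j, i) 1 + Finsupp.single (k, l) 1) := by
    rw [← add_assoc, hswap]
    abel
  exact (add_right_cancel hcancel).symm

/-- The pairing with the generic determinant for which the monomials form an orthonormal basis. It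
separates determinants from the permanental ideal, since transposing two columns reverses the signs
of the determinant. -/
noncomputable def detPairing : MvPolynomial (ι × ι) R →ₗ[R] R :=
  ∑ s : Equiv.Perm ι, ((Equiv.Perm.sign s : ℤ) : R) • lcoeff R (permExp s)

theorem detPairing_apply (p : MvPolynomial (ι × ι) R) :
    detPairing p = ∑ s : Equiv.Perm ι, ((Equiv.Perm.sign s : ℤ) : R) * p.coeff (permExp s) := by
  simp [detPairing]

theorem detPairing_monomial_mul_eq_zero (j k i l : ι) (m : ι × ι →₀ ℕ) (c : R) :
    detPairing (monomial m c * (X (j, i) * X (k, l) + X (j, l) * X (k, i))) = 0 := by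
  have hmonomial (u v : ι × ι) : monomial m c * (X u * X v) =
      monomial (m + Finsupp.single u 1 + Finsupp.single v 1) c := by
    rw [X, X, ← mul_assoc, monomial_mul, monomial_mul, mul_one, mul_one]
  rw [mul_add, map_add, hmonomial, hmonomial, detPairing_apply, detPairing_apply]
  simp only [coeff_monomial]
  rcases eq_or_ne i l with rfl | hil
  · simp only [add_single_add_single_ne_permExp, if_false, mul_zero, Finset.sum_const_zero,
      add_zero]
  have hiff (s : Equiv.Perm ι) :
      m + Finsupp.single (j, l) 1 + Finsupp.single (k, i) 1 = permExp (s * Equiv.swap i l) ↔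
        m + Finsupp.single (j, i) 1 + Finsupp.single (k, l) 1 = permExp s := by
    refine ⟨fun h => ?_, permExp_mul_swap_eq hil⟩
    rw [permExp_mul_swap_eq hil.symm h, Equiv.swap_comm l i, Equiv.mul_swap_mul_self]
  rw [← Equiv.sum_comp (Equiv.mulRight (Equiv.swap i l)) fun s =>
      ((Equiv.Perm.sign s : ℤ) : R) *
        if m + Finsupp.single (j, l) 1 + Finsupp.single (k, i) 1 = permExp s then c else 0,
    ← Finset.sum_add_distrib]
  refine Finset.sum_eq_zero fun s _ => ?_
  simp only [Equiv.coe_mulRight, hiff, Equiv.Perm.sign_mul, Equiv.Perm.sign_swap hil, mul_neg,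
    mul_one, Units.val_neg, Int.cast_neg, neg_mul, add_neg_cancel]

theorem detPairing_eq_zero_of_mem_permanentalIdeal {p : MvPolynomial (ι × ι) R}
    (hp : p ∈ permanentalIdeal ι R) : detPairing p = 0 := by
  suffices h : ∀ q, detPairing (q * p) = 0 by simpa using h 1
  induction hp using Submodule.span_induction with
  | mem _ h =>
    obtain ⟨j, k, i, l, rfl⟩ := h
    intro q
    induction q using MvPolynomial.induction_on' with
    | monomial m c => exact detPairing_monomial_mul_eq_zero j k i l m c
    | add q q' hq hq' => rw [add_mul, map_add, hq, hq', add_zero]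
  | zero => simp
  | add p p' _ _ hp hp' => exact fun q => by rw [mul_add, map_add, hp, hp', add_zero]
  | smul a p _ hp => exact fun q => by rw [smul_eq_mul, ← mul_assoc, hp]

theorem detPairing_det_hadamard (r : Matrix ι ι R) :
    detPairing (r.map C ⊙ Matrix.mvPolynomialX ι ι R).det = r.permanent := by
  have hprod (s : Equiv.Perm ι) : ∏ i, (r.map C ⊙ Matrix.mvPolynomialX ι ι R) (s i) i =
      monomial (permExp s) (∏ i, r (s i) i) := by
    simp only [Matrix.hadamard_apply, Matrix.map_apply, Matrix.mvPolynomialX_apply,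
      Finset.prod_mul_distrib, permExp, monomial_sum_index, map_prod, X]
  simp only [detPairing_apply, Matrix.det_apply', hprod, coeff_sum,
    ← map_intCast (C : R →+* MvPolynomial (ι × ι) R), coeff_C_mul,
    coeff_monomial, permExp_injective.eq_iff, mul_ite, mul_zero, Finset.sum_ite_eq',
    Finset.mem_univ, if_true, Matrix.permanent]
  refine Finset.sum_congr rfl fun s _ => ?_
  rw [← mul_assoc, ← Int.cast_mul, ← Units.val_mul, Int.units_mul_self, Units.val_one,
    Int.cast_one, one_mul]

theorem det_hadamard_notMem_permanentalIdeal {r : Matrix ι ι R} (hr : r.permanent ≠ 0) :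
    (r.map C ⊙ Matrix.mvPolynomialX ι ι R).det ∉ permanentalIdeal ι R := fun h =>
  hr (detPairing_det_hadamard r ▸ detPairing_eq_zero_of_mem_permanentalIdeal h)

theorem permanent_natCast_ne_zero [CharZero R] {r : Matrix ι ι ℕ} (hr : ∀ j i, 0 < r j i) :
    (r.map (Nat.cast : ℕ → R)).permanent ≠ 0 := by
  have hcast : (r.map (Nat.cast : ℕ → R)).permanent = (r.permanent : R) := by
    simp [Matrix.permanent]
  rw [hcast, Nat.cast_ne_zero, ← Nat.pos_iff_ne_zero]
  exact Finset.sum_pos (fun s _ => Finset.prod_pos fun i _ => hr _ i) Finset.univ_nonempty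

end Permanental

section MatrixForm

variable {S : Type*} [CommRing S] {n : ℕ}

theorem linForm_isHomogeneous (a : Fin (n + 1) → S) : (linForm a).IsHomogeneous 1 :=
  IsHomogeneous.sum _ _ _ fun j _ => (isHomogeneous_X S j).C_mul (a j)

theorem linForm_mul_linForm_eq_zero (h2 : IsUnit (2 : S)) {a b : Fin (n + 1) → S}
    (h : ∀ i l, a i * b l + a l * b i = 0) : linForm a * linForm b = 0 := by
  have hexpand : linForm a * linForm b = ∑ i, ∑ l, C (a i * b l) * (X i * X l) := by
    simp only [linForm, Finset.sum_mul_sum, C_mul, mul_mul_mul_comm]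
  have hswap : linForm a * linForm b = ∑ i, ∑ l, C (a l * b i) * (X i * X l) := by
    rw [hexpand, Finset.sum_comm]
    exact Finset.sum_congr rfl fun i _ => Finset.sum_congr rfl fun l _ => by rw [mul_comm (X l)]
  have hdouble : C (2 : S) * (linForm a * linForm b) = 0 :=
    calc C (2 : S) * (linForm a * linForm b)
        = linForm a * linForm b + linForm a * linForm b := by rw [map_ofNat, two_mul]
      _ = ∑ i, ∑ l, C (a i * b l + a l * b i) * (X i * X l) := by
          nth_rewrite 2 [hswap]
          simp only [hexpand, C_add, add_mul, Finset.sum_add_distrib]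
      _ = 0 := by simp only [h, C_0, zero_mul, Finset.sum_const_zero]
  exact (h2.map C).mul_right_eq_zero.1 hdouble

/-- The form `∑ j, x_j ^ (d - 1) * ℓ_j`, where `ℓ_j` is the linear form with coefficients in the
`j`-th row of `Z`. Its partial derivatives contain the entries of `Z`, up to positive multiples, as
the coefficients of the pure powers `x_j ^ (d - 1)`. -/
noncomputable def matrixForm (d : ℕ) (Z : Matrix (Fin (n + 1)) (Fin (n + 1)) S) :
    MvPolynomial (Fin (n + 1)) S :=
  ∑ j, X j ^ (d - 1) * linForm (Z j)

theorem matrixForm_isHomogeneous {d : ℕ} (hd : 1 ≤ d)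
    (Z : Matrix (Fin (n + 1)) (Fin (n + 1)) S) : (matrixForm d Z).IsHomogeneous d :=
  IsHomogeneous.sum _ _ _ fun j _ => by
    simpa [Nat.sub_add_cancel hd] using (isHomogeneous_X_pow j (d - 1)).mul
      (linForm_isHomogeneous (Z j))

theorem coeff_matrixForm {d : ℕ} (hd : 3 ≤ d) (Z : Matrix (Fin (n + 1)) (Fin (n + 1)) S)
    (j i : Fin (n + 1)) :
    (matrixForm d Z).coeff (Finsupp.single j (d - 1) + Finsupp.single i 1) = Z j i := by
  have hexpand : matrixForm d Z =
      ∑ k, ∑ l, monomial (Finsupp.single k (d - 1) + Finsupp.single l 1) (Z k l) := by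
    simp only [matrixForm, linForm, Finset.mul_sum, X_pow_eq_monomial, C_mul_X_eq_monomial,
      monomial_mul, one_mul]
  have hexponent (k l : Fin (n + 1)) : Finsupp.single k (d - 1) + Finsupp.single l 1 =
      Finsupp.single j (d - 1) + Finsupp.single i 1 ↔ k = j ∧ l = i := by
    rw [Finsupp.single_add_single_eq_single_add_single (by omega) one_ne_zero]
    omega
  simp only [hexpand, coeff_sum, coeff_monomial, hexponent]
  simp [ite_and]

/-- The exponent of the pure power `x_j ^ m`, which indexes a row of the matrix of rank equations
when `m = d - 1`. -/
noncomputable def pureExp (m : ℕ) (j : Fin (n + 1)) : Exps m n :=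
  ⟨Finsupp.single j m, Finset.mem_finsuppAntidiag.2
    ⟨Finsupp.univ_sum_single_apply j m, Finset.subset_univ _⟩⟩

theorem aeval_rankMatrix_pureExp {K : Type*} [Field K] [Algebra K S] {d : ℕ} (hd : 3 ≤ d)
    (Z : Matrix (Fin (n + 1)) (Fin (n + 1)) S) (j i : Fin (n + 1)) :
    aeval (fun α => (matrixForm d Z).coeff α.1) (rankMatrix K d n (pureExp (d - 1) j) i) =
      ((Finsupp.single j (d - 1) i + 1 : ℕ) : S) * Z j i := by
  rw [aeval_rankMatrix, formOf_coeff (matrixForm_isHomogeneous (by omega) Z), coeff_pderiv,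
    pureExp, coeff_matrixForm hd, Nat.cast_add_one, mul_comm]

theorem brillForm_matrixForm_eq_zero (h2 : IsUnit (2 : S))
    {Z : Matrix (Fin (n + 1)) (Fin (n + 1)) S}
    (hZ : ∀ j k i l, Z j i * Z k l + Z j l * Z k i = 0) {d : ℕ} (hd : 3 ≤ d) :
    brillForm d (matrixForm d Z) = 0 := by
  refine brillForm_eq_zero (L := Set.range fun j => linForm (Z j)) ?_ ?_ ?_ hd
  · rintro _ ⟨j, rfl⟩
    exact linForm_isHomogeneous _
  · rw [pow_two, Ideal.span_mul_span', Ideal.span_eq_bot]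
    rintro _ ⟨_, ⟨j, rfl⟩, _, ⟨k, rfl⟩, rfl⟩
    exact linForm_mul_linForm_eq_zero h2 (hZ j k)
  · exact Ideal.sum_mem _ fun j _ => Ideal.mul_mem_left _ _ (Ideal.subset_span ⟨j, rfl⟩)

theorem not_rankIdeal_le_brillIdeal (K : Type*) [Field K] [CharZero K] {d : ℕ} (hd : 3 ≤ d)
    (n : ℕ) : ¬ rankIdeal K d n (n + 1) ≤ brillIdeal K d n := by
  let ι := Fin (n + 1)
  let A := MvPolynomial (ι × ι) K ⧸ permanentalIdeal ι K
  let π : MvPolynomial (ι × ι) K →ₐ[K] A := Ideal.Quotient.mkₐ K (permanentalIdeal ι K)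
  let Z : Matrix ι ι A := (Matrix.mvPolynomialX ι ι K).map π
  let r : Matrix ι ι ℕ := Matrix.of fun j i => Finsupp.single j (d - 1) i + 1
  have h2 : IsUnit (2 : A) :=
    map_ofNat (algebraMap K A) 2 ▸ (IsUnit.mk0 (2 : K) two_ne_zero).map (algebraMap K A)
  have hZ (j k i l : ι) : Z j i * Z k l + Z j l * Z k i = 0 :=
    Ideal.Quotient.eq_zero_iff_mem.2 (Ideal.subset_span ⟨j, k, i, l, rfl⟩)
  have hbrill : brillForm d (formOf d n fun α => (matrixForm d Z).coeff α.1) = 0 := by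
    rw [formOf_coeff (matrixForm_isHomogeneous (by omega) Z), brillForm_matrixForm_eq_zero h2 hZ hd]
  have hminor : (aeval fun α => (matrixForm d Z).coeff α.1).mapMatrix
      ((rankMatrix K d n).submatrix (pureExp (d - 1)) id) =
      π.mapMatrix ((r.map (Nat.cast : ℕ → K)).map C ⊙ Matrix.mvPolynomialX ι ι K) := by
    ext j i
    simp [aeval_rankMatrix_pureExp hd, Z, r]
  intro hle
  have hdet := brillIdeal_le_ker_aeval hbrill
    (hle (Ideal.subset_span ⟨pureExp (d - 1), id, rfl⟩))
  rw [RingHom.mem_ker, AlgHom.map_det, hminor, ← AlgHom.map_det] at hdet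
  exact det_hadamard_notMem_permanentalIdeal
    (permanent_natCast_ne_zero fun _ _ => Nat.succ_pos _) (Ideal.Quotient.eq_zero_iff_mem.1 hdet)

end MatrixForm

end Chow

theorem mainTheorem8_general (K : Type*) [Field K] [CharZero K] (d n r : ℕ) (hd : 3 ≤ d)
    (hdr : d < r) (hrn : r ≤ n + 1) :
    Chow.brillIdeal K d n ≠ Chow.chowIdeal K d n ∧
      Chow.rankIdeal K d n r ≤ Chow.chowIdeal K d n ∧
      ¬ Chow.rankIdeal K d n r ≤ Chow.brillIdeal K d n := by
  have hchow := Chow.rankIdeal_le_chowIdeal K n hdr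
  have hbrill : ¬ Chow.rankIdeal K d n r ≤ Chow.brillIdeal K d n := fun h =>
    Chow.not_rankIdeal_le_brillIdeal K hd n ((Chow.rankIdeal_antitone K d n hrn).trans h)
  exact ⟨fun heq => hbrill (heq ▸ hchow), hchow, hbrill⟩

theorem mainTheorem8 (K : Type*) [Field K] [IsAlgClosed K] [CharZero K] (d n : ℕ)
    (hd : 3 ≤ d) (hn : d ≤ n) :
    Chow.brillIdeal K d n ≠ Chow.chowIdeal K d n ∧
      Chow.rankIdeal K d n (d + 1) ≤ Chow.chowIdeal K d n ∧
      ¬ Chow.rankIdeal K d n (d + 1) ≤ Chow.brillIdeal K d n :=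
  mainTheorem8_general K d n (d + 1) hd (by omega) (by omega)
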